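/- Let $K$ be a field of characteristic $0$ and let $\mathrm{NSym}=K\langle\Lambda_1,\Lambda_2,\dots\rangle$ be the free associative algebra of noncommutative symmetric functions, with $\Lambda_0=1$. Let $\mathrm{Sym}$ be the algebra of symmetric functions over $K$ in commuting variables $x_1,x_2,\dots$ (symmetric formal power series of bounded degree), and let $\rho\colon\mathrm{NSym}\to\mathrm{Sym}$ be the algebra homomorphism with $\rho(\Lambda_k)=e_k$ for all $k\ge1$, where $e_k$ is the $k$th elementary symmetric function. An element $F\in\mathrm{NSym}$ is a noncommutative analog of $f\in\mathrm{Sym}$ if $\rho(F)=f$. Put $\lambda(t)=\sum_{n\ge0}\Lambda_nt^n$, where $t$ commutes with all $\Lambda_k$, and define $S_n$ and $\Psi_n$ by $\sum_{n\ge0}S_nt^n=\sigma(t)=\lambda(-t)^{-1}$ and $\sum_{n\ge1}\Psi_nt^{n-1}=\lambda(-t)\,\sigma'(t)$. For a composition $I=i_1i_2\cdots i_l\vDash n$ (a sequence of positive integers with sum $n$) put $\varepsilon^I=(-1)^{n-l}$, let $m_1(I)$ be the number of parts of $I$ equal to $1$, and set $\Lambda^I=\Lambda_{i_1}\cdots\Lambda_{i_l}$,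 $S^I=S_{i_1}\cdots S_{i_l}$ and $\Psi^I=\Psi_{i_1}\cdots\Psi_{i_l}$. The ribbon Schur function $R_I$ is defined by $\varepsilon^IR_I=\sum_{J}\varepsilon^JS^J$, summed over all compositions $J$ of $n$ such that $I$ is a refinement of $J$. **Theorem.** Let $n\ge1$, let $P_n$ be the path on $n$ vertices, and let $X_{P_n}=\sum_c\prod_v x_{c(v)}$, summed over the proper colorings $c\colon V(P_n)\to\{1,2,\dots\}$, be its chromatic symmetric function. Let $\mathcal C_n$ be the set of compositions of $n$ in which every part is $1$ or $2$ and the last part is $1$. Then $X_{P_n}$ has the noncommutative analog $$\widetilde X_{P_n}=\sum_{I\vDash n}\varepsilon^I\Psi^I=\sum_{I=i_1\cdots i_l\vDash n}i_1(i_2-1)\cdots(i_l-1)\,\Lambda^I=\frac12\sum_{I\in\mathcal C_n}2^{m_1(I)}R_I .$$ -/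

import Mathlib

noncomputable section

namespace NCSF

/-! ### Commutative symmetric functions -/

/-- The algebra `Sym` of symmetric functions over `K`: formal power series of bounded degree in
the variables `x₁, x₂, …` that are invariant under every permutation of the variables. -/
def Sym (K : Type*) [Field K] : Subalgebra K (MvPowerSeries ℕ+ K) where
  carrier := {f | (∀ π : Equiv.Perm ℕ+, MvPowerSeries.renameEquiv K π f = f) ∧
    ∃ N : ℕ, ∀ d : ℕ+ →₀ ℕ, MvPowerSeries.coeff d f ≠ 0 → d.degree ≤ N}
  mul_mem' := by
    classical
    rintro f g ⟨hf, N, hN⟩ ⟨hg, M, hM⟩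
    refine ⟨fun π => by rw [map_mul, hf, hg], N + M, fun d hd => ?_⟩
    rw [MvPowerSeries.coeff_mul] at hd
    obtain ⟨p, hp, hne⟩ := Finset.exists_ne_zero_of_sum_ne_zero hd
    rw [← Finset.HasAntidiagonal.mem_antidiagonal.mp hp, map_add]
    exact add_le_add (hN _ (left_ne_zero_of_mul hne)) (hM _ (right_ne_zero_of_mul hne))
  add_mem' := by
    rintro f g ⟨hf, N, hN⟩ ⟨hg, M, hM⟩
    refine ⟨fun π => by rw [map_add, hf, hg], max N M, fun d hd => ?_⟩
    by_cases h : MvPowerSeries.coeff d f = 0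
    · refine le_max_of_le_right (hM d fun h' => hd ?_)
      rw [map_add, h, h', add_zero]
    · exact le_max_of_le_left (hN d h)
  algebraMap_mem' := by
    classical
    intro r
    refine ⟨fun π => AlgEquiv.commutes _ r, 0, fun d hd => ?_⟩
    rw [MvPowerSeries.algebraMap_apply, Algebra.algebraMap_self, RingHom.id_apply,
      MvPowerSeries.coeff_C] at hd
    have h0 : d = 0 := by
      by_contra h
      exact hd (if_neg h)
    simp [h0]

/-- A power series whose coefficients are invariant under permuting the variables is fixed by
those permutations. -/
theorem renameEquiv_eq_self {K : Type*} [Field K] (f : MvPowerSeries ℕ+ K)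
    (π : Equiv.Perm ℕ+)
    (h : ∀ d : ℕ+ →₀ ℕ,
      MvPowerSeries.coeff (d.mapDomain π) f = MvPowerSeries.coeff d f) :
    MvPowerSeries.renameEquiv K π f = f := by
  ext d
  obtain ⟨c, rfl⟩ : ∃ c : ℕ+ →₀ ℕ, c.mapDomain π = d :=
    ⟨d.mapDomain π.symm, by rw [← Finsupp.mapDomain_comp]; simp⟩
  rw [h c]
  have := MvPowerSeries.coeff_embDomain_rename π.toEmbedding f c
  rw [Finsupp.embDomain_eq_mapDomain] at this
  exact this

/-- The elementary symmetric function `e_k = ∑_{i₁ < ⋯ < i_k} x_{i₁} ⋯ x_{i_k}`: the coefficient of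
a monomial is `1` if it is a product of `k` distinct variables, and `0` otherwise. -/
def elem (K : Type*) [Field K] (k : ℕ) : Sym K :=
  open Classical in
  ⟨fun d => if d.degree = k ∧ ∀ i, d i ≤ 1 then 1 else 0, by
    classical
    refine ⟨fun π => renameEquiv_eq_self _ π fun d => ?_, k, fun d hd => ?_⟩
    · have h1 : (d.mapDomain π).degree = d.degree := by
        simp [Finsupp.degree_mapDomain]
      have h2 : (∀ i, d.mapDomain π i ≤ 1) ↔ ∀ i, d i ≤ 1 := by
        rw [π.forall_congr_right.symm]
        simp [Finsupp.mapDomain_apply π.injective]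
      exact if_congr (and_congr (by rw [h1]) h2) rfl rfl
    · by_contra h
      exact hd (if_neg fun h' => h h'.1.le)⟩

/-- The monomial `∏_v x_{c(v)}` of a map `c : V → {1, 2, …}`, as an exponent vector. -/
def colorMonomial {V : Type*} [Fintype V] (c : V → ℕ+) : ℕ+ →₀ ℕ :=
  ∑ v, Finsupp.single (c v) 1

/-- The chromatic symmetric function `X_G = ∑_c ∏_v x_{c(v)}` of a finite simple graph, summed over
the proper colorings `c : V → {1, 2, …}`: the coefficient of a monomial is the (finite) number of
proper colorings with that monomial. -/
def chromaticSym (K : Type*) [Field K] {V : Type*} [Fintype V] (G : SimpleGraph V) : Sym K :=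
  ⟨fun d => (Nat.card {c : G.Coloring ℕ+ // colorMonomial c = d} : K), by
    refine ⟨fun π => renameEquiv_eq_self _ π fun d => ?_, Fintype.card V, fun d hd => ?_⟩
    · change (Nat.card _ : K) = (Nat.card _ : K)
      congr 1
      have key : ∀ (π : Equiv.Perm ℕ+) (c : V → ℕ+),
          colorMonomial (fun v => π (c v)) = (colorMonomial c).mapDomain π := by
        intro π c
        simp [colorMonomial, Finsupp.mapDomain_finsetSum, Finsupp.mapDomain_single]
      let act (π : Equiv.Perm ℕ+) (c : G.Coloring ℕ+) : G.Coloring ℕ+ :=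
        SimpleGraph.Coloring.mk (fun v => π (c v)) fun h h' => c.valid h (π.injective h')
      have hact : ∀ (π : Equiv.Perm ℕ+) (c : G.Coloring ℕ+),
          colorMonomial (act π c) = (colorMonomial c).mapDomain π := fun π c => key π c
      refine Nat.card_congr
        { toFun := fun c => ⟨act π.symm c.1, ?_⟩
          invFun := fun c => ⟨act π c.1, ?_⟩
          left_inv := fun c => ?_
          right_inv := fun c => ?_ }
      · rw [hact, c.2, ← Finsupp.mapDomain_comp]; simp
      · rw [hact, c.2]
      · exact Subtype.ext (RelHom.ext fun v => π.apply_symm_apply _)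
      · exact Subtype.ext (RelHom.ext fun v => π.symm_apply_apply _)
    · have hne : Nat.card {c : G.Coloring ℕ+ // colorMonomial c = d} ≠ 0 := fun h => hd (by
        change (Nat.card _ : K) = 0
        rw [h, Nat.cast_zero])
      obtain ⟨⟨c, hc⟩⟩ := (Nat.card_ne_zero.mp hne).1
      rw [← hc]
      simp [colorMonomial, map_sum, Finsupp.degree_single]⟩

/-! ### Noncommutative symmetric functions -/

/-- The algebra of noncommutative symmetric functions: the free associative algebra over `K` on
generators `Λ₁, Λ₂, …`. -/
abbrev NSym (K : Type*) [Field K] : Type _ := FreeAlgebra K ℕ+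

variable (K : Type*) [Field K]

/-- The elementary function `Λ_k`, with `Λ₀ = 1`. -/
def Lam : ℕ → NSym K
  | 0 => 1
  | k + 1 => FreeAlgebra.ι K k.succPNat

/-- The series `λ(-t) = ∑_{n ≥ 0} (-1)ⁿ Λ_n tⁿ`. -/
def lamNeg : PowerSeries (NSym K) := PowerSeries.mk fun n => (-1) ^ n * Lam K n

/-- The series `σ(t) = 1 / λ(-t)`, the two-sided inverse of `λ(-t)`. -/
def sigma : PowerSeries (NSym K) := PowerSeries.invOfUnit (lamNeg K) 1

/-- The complete homogeneous function `S_n`, the coefficient of `tⁿ` in `σ(t)`. -/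
def S (n : ℕ) : NSym K := PowerSeries.coeff n (sigma K)

/-- The formal derivative `σ'(t) = ∑_{n ≥ 0} (n + 1) S_{n+1} tⁿ`. -/
def sigmaDeriv : PowerSeries (NSym K) := PowerSeries.mk fun n => ((n : NSym K) + 1) * S K (n + 1)

/-- The series `ψ(t) = λ(-t) σ'(t)`. -/
def psi : PowerSeries (NSym K) := lamNeg K * sigmaDeriv K

/-- The power sum of the first kind: `ψ(t) = ∑_{n ≥ 1} Ψ_n t^{n-1}`. Only `n ≥ 1` is meaningful;
the value at `0` is a placeholder. -/
def Psi : ℕ → NSym K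
  | 0 => 0
  | n + 1 => PowerSeries.coeff n (psi K)

variable {n : ℕ}

/-- `Λ^I = Λ_{i₁} Λ_{i₂} ⋯`. -/
def LamComp (I : Composition n) : NSym K := (I.blocks.map (Lam K)).prod

/-- `S^I = S_{i₁} S_{i₂} ⋯`. -/
def SComp (I : Composition n) : NSym K := (I.blocks.map (S K)).prod

/-- `Ψ^I = Ψ_{i₁} Ψ_{i₂} ⋯`. -/
def PsiComp (I : Composition n) : NSym K := (I.blocks.map (Psi K)).prod

/-- The sign `ε^I = (-1)^{n - ℓ(I)}` of a composition `I` of `n`. -/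
def sign (I : Composition n) : K := (-1) ^ (n - I.length)

variable {K} in
/-- `J.Refines I`: the parts of `J` can be cut into consecutive groups whose sums are the successive
parts of `I`. In the reverse refinement order this reads `I ⪯ J`. -/
def Refines (J I : Composition n) : Prop :=
  ∃ L : List (List ℕ), L.flatten = J.blocks ∧ L.map List.sum = I.blocks

open Classical in
/-- The ribbon Schur function `R_I`, given by `ε^I R_I = ∑_{J ⪯ I} ε^J S^J`, a sum over the
compositions `J` of which `I` is a refinement. -/
def ribbon (I : Composition n) : NSym K :=
  sign K I • ∑ J : Composition n with Refines I J, sign K J • SComp K J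

open Classical in
theorem sign_smul_ribbon (I : Composition n) :
    sign K I • ribbon K I = ∑ J : Composition n with Refines I J, sign K J • SComp K J := by
  rw [ribbon, smul_smul, sign, ← mul_pow]
  simp

/-- The projection `ρ : NSym → Sym` that lets the variables commute, sending `Λ_k` to `e_k`. -/
def rho : NSym K →ₐ[K] Sym K := FreeAlgebra.lift K fun k : ℕ+ => elem K k

variable {K} in
/-- `F` is a noncommutative analog of the symmetric function `f` if `ρ(F) = f`. -/
def IsNoncommAnalog (F : NSym K) (f : Sym K) : Prop := rho K F = f

/-- The integer `i₁ (i₂ - 1) (i₃ - 1) ⋯ (i_l - 1)` attached to a list `i₁, …, i_l`, in `K`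
(the empty product `1` for the empty list). -/
def lamCoeff : List ℕ → K
  | [] => 1
  | i :: l => (i : K) * (l.map fun j : ℕ => (j : K) - 1).prod

/-- The set `C_n` of compositions of `n` with all parts in `{1, 2}` and last part `1`. -/
def C (n : ℕ) : Finset (Composition n) :=
  {I | (∀ i ∈ I.blocks, i = 1 ∨ i = 2) ∧ I.blocks.getLast? = some 1}

/-- The number `m₁(I)` of parts of `I` equal to `1`. -/
def mOne (I : Composition n) : ℕ := I.blocks.count 1

end NCSF

end

/-! Write E = t d/dt and D = σ(-t) + Eσ(-t) (`denom`). D has constant term 1, so D Z = σ(-t)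
determines Z, and all three expansions have generating series solving this equation. For Ψ,
splitting off the first part gives Z = 1 + tψ(-t) Z with tψ(-t) = -λ(t) Eσ(-t); multiply by σ(-t)
(`denom_mul_psiSeries`). For Λ, geometric summation gives Z = λ (λ - Eλ)⁻¹, and Dλ = σ(-t)(λ - Eλ)
by differentiating σ(-t)λ(t) = 1 (`denom_mul_lamSeries`). For ribbons, expand R_I in the S^J and
exchange the sums: S^J gets ε^J times the total signed weight of the words of C_n refining J.
Removing a leading 1 (weight 2) or 2 (weight -1) makes that weight affine in each part, namely
2(j₁+1)⋯(j_{l-1}+1)j_l (`refinementSum_eq`). The resulting series H satisfies DH = -Eσ(-t), so D(1 +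
H) = σ(-t) (`denom_mul_completeSeries`). Finally ρ(Ψ_n) = p_n by Newton's identities (`rhoVal_Psi`),
and both ρ of the Ψ-expansion and X_{P_n} satisfy X_{n+1} = ∑ (-1)^k p_{k+1} X_{n-k}
(`chromaticSym_pathGraph_succ`). -/

noncomputable section

namespace NCSF

open PowerSeries

/-! ### Sums over compositions -/

/-- The sum of a function of the list of parts over all compositions of `n`. -/
def compSum {A : Type*} [AddCommMonoid A] (f : List ℕ → A) (n : ℕ) : A :=
  ∑ I : Composition n, f I.blocks

theorem compSum_zero {A : Type*} [AddCommMonoid A] (f : List ℕ → A) : compSum f 0 = f [] := by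
  have h : ∀ I : Composition 0, I.blocks = [] := fun I =>
    List.eq_nil_iff_forall_not_mem.mpr fun i hi => by
      have := List.single_le_sum (l := I.blocks) (by simp) i hi
      have := I.blocks_pos hi
      have := I.blocks_sum
      omega
  simp [compSum, h, composition_card]

/-- Splitting off the first part of a composition. -/
theorem compSum_succ {A : Type*} [AddCommMonoid A] (f : List ℕ → A) (n : ℕ) :
    compSum f (n + 1) = ∑ k ∈ Finset.range (n + 1), compSum (fun l => f ((k + 1) :: l)) (n - k) := by
  rw [Finset.sum_range, compSum]
  simp only [compSum]
  rw [← Fintype.sum_sigma' (fun (k : Fin (n + 1)) (I : Composition (n - k)) =>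
    f ((k.1 + 1) :: I.blocks))]
  let e : (Σ k : Fin (n + 1), Composition (n - k)) → Composition (n + 1) := fun x =>
    ⟨(x.1.1 + 1) :: x.2.blocks, by
      intro i hi
      rcases List.mem_cons.mp hi with rfl | hi
      · omega
      · exact x.2.blocks_pos hi, by
      have := x.1.2
      rw [List.sum_cons, x.2.blocks_sum]; omega⟩
  refine (Function.Bijective.sum_comp (e := e) ⟨?_, ?_⟩ fun I => f I.blocks).symm
  · rintro ⟨k, I⟩ ⟨k', I'⟩ h
    have h := congrArg Composition.blocks h
    simp only [e, List.cons.injEq, add_left_inj] at h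
    obtain rfl : k = k' := Fin.ext h.1
    obtain rfl : I = I' := Composition.ext h.2
    rfl
  · rintro ⟨_ | ⟨a, l⟩, hpos, hsum⟩
    · simp at hsum
    · have ha : 0 < a := hpos (by simp)
      rw [List.sum_cons] at hsum
      refine ⟨⟨⟨a - 1, by omega⟩, ⟨l, fun h => hpos (by simp [h]), by simp only; omega⟩⟩, ?_⟩
      apply Composition.ext
      simp only [e]
      congr 1
      omega

theorem compSum_congr {A : Type*} [AddCommMonoid A] {f g : List ℕ → A} {n : ℕ}
    (h : ∀ l : List ℕ, (∀ i ∈ l, 0 < i) → l.sum = n → f l = g l) : compSum f n = compSum g n :=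
  Finset.sum_congr rfl fun I _ => h _ (fun _ hi => I.blocks_pos hi) I.blocks_sum

/-- The generating series of a sum over compositions of products in which the first part is
weighted separately, with a correction for compositions with one part. -/
theorem mk_compSum {A : Type*} [Ring A] (f g : List ℕ → A) (v w : ℕ → A)
    (h : ∀ i l, f (i :: l) = v i * g l + if l = [] then w i else 0) :
    PowerSeries.mk (compSum f) = PowerSeries.C (f []) + X * PowerSeries.mk (fun n => v (n + 1)) *
      PowerSeries.mk (compSum g) + X * PowerSeries.mk (fun n => w (n + 1)) := by
  ext n
  rcases n with _ | n
  · simp [compSum_zero]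
  · have h1 : ∀ m, compSum (fun l => if l = [] then (1 : A) else 0) m = if m = 0 then 1 else 0 := by
      intro m
      rcases m with _ | m
      · simp [compSum_zero]
      · simp [compSum]
    have h2 : ∀ i m, compSum (fun l => f (i :: l)) m =
        v i * compSum g m + w i * if m = 0 then 1 else 0 := by
      intro i m
      rw [← h1, compSum, compSum, compSum, Finset.mul_sum, Finset.mul_sum,
        ← Finset.sum_add_distrib]
      exact Finset.sum_congr rfl fun I _ => by rw [h]; simp
    rw [map_add, map_add, mul_assoc, coeff_succ_X_mul, coeff_succ_X_mul, coeff_mk, coeff_mk,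
      compSum_succ, coeff_succ_C, zero_add, coeff_mul,
      Finset.Nat.sum_antidiagonal_eq_sum_range_succ_mk]
    simp only [h2, Finset.sum_add_distrib, coeff_mk]
    congr 1
    -- The correction needs an empty tail, hence a first part equal to the whole of n + 1, that is k
    -- = n.
    rw [Finset.sum_eq_single n]
    · simp
    · intro k hk hkn
      rw [if_neg, mul_zero]
      rw [Finset.mem_range] at hk
      omega
    · simp

/-! ### Power series over a noncommutative ring -/

section Series

variable {A : Type*} [Ring A]

/-- The substitution `t ↦ -t`. -/
def negVar (f : PowerSeries A) : PowerSeries A := PowerSeries.mk fun n => (-1) ^ n * coeff n f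

theorem negVar_mul (f g : PowerSeries A) : negVar (f * g) = negVar f * negVar g := by
  ext n
  rw [negVar, coeff_mk, coeff_mul, coeff_mul, Finset.mul_sum]
  refine Finset.sum_congr rfl fun p hp => ?_
  rw [← Finset.HasAntidiagonal.mem_antidiagonal.mp hp, negVar, negVar, coeff_mk, coeff_mk, pow_add]
  rcases neg_one_pow_eq_or A p.1 with h | h <;> rcases neg_one_pow_eq_or A p.2 with h' | h' <;>
    simp [h, h']

theorem negVar_one : negVar (1 : PowerSeries A) = 1 := by
  ext n
  rcases n with _ | n <;> simp [negVar, coeff_one]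

/-- The Euler derivation `t d/dt`. -/
def euler (f : PowerSeries A) : PowerSeries A := PowerSeries.mk fun n => (n : A) * coeff n f

theorem euler_mul (f g : PowerSeries A) : euler (f * g) = euler f * g + f * euler g := by
  ext n
  rw [euler, coeff_mk, map_add, coeff_mul, coeff_mul, coeff_mul, Finset.mul_sum,
    ← Finset.sum_add_distrib]
  refine Finset.sum_congr rfl fun p hp => ?_
  rw [← Finset.HasAntidiagonal.mem_antidiagonal.mp hp, euler, euler, coeff_mk, coeff_mk, Nat.cast_add, add_mul,
    mul_assoc, ← mul_assoc (coeff p.1 f), (Nat.cast_commute p.2 (coeff p.1 f)).eq.symm, mul_assoc]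

theorem euler_one : euler (1 : PowerSeries A) = 0 := by
  ext n
  rcases n with _ | n <;> simp [euler, coeff_one]

end Series

/-! ### The basic series of noncommutative symmetric functions -/

variable (K : Type*) [Field K]

/-- The series `λ(t)`. -/
def lam : PowerSeries (NSym K) := PowerSeries.mk (Lam K)

/-- The series `σ(-t)`, the inverse of `λ(t)`. -/
def sigmaNeg : PowerSeries (NSym K) := negVar (sigma K)

theorem lamNeg_eq : negVar (lamNeg K) = lam K := by
  ext n
  rw [negVar, coeff_mk, lamNeg, coeff_mk, lam, coeff_mk, ← mul_assoc]
  rcases neg_one_pow_eq_or (NSym K) n with h | h <;> simp [h]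

theorem lam_mul_sigmaNeg : lam K * sigmaNeg K = 1 := by
  rw [← lamNeg_eq, sigmaNeg, ← negVar_mul, sigma, mul_invOfUnit, negVar_one]
  simp [lamNeg, Lam]

theorem sigmaNeg_mul_lam : sigmaNeg K * lam K = 1 := by
  rw [← lamNeg_eq, sigmaNeg, ← negVar_mul, sigma, invOfUnit_mul, negVar_one]
  simp [lamNeg, Lam]

theorem coeff_sigmaNeg (n : ℕ) : coeff n (sigmaNeg K) = (-1) ^ n * S K n := by
  simp [sigmaNeg, negVar, S]

theorem S_zero : S K 0 = 1 := by
  simp [S, sigma]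

/-- Apply the derivation t d/dt to σ(-t)λ(t) = 1, keeping the order of the factors. -/
theorem euler_sigmaNeg_mul_lam : -euler (sigmaNeg K) * lam K = sigmaNeg K * euler (lam K) := by
  have h := euler_mul (sigmaNeg K) (lam K)
  rw [sigmaNeg_mul_lam, euler_one] at h
  rw [neg_mul, neg_eq_iff_add_eq_zero, ← h]

theorem X_mul_psi :
    X * PowerSeries.mk (fun n => (-1) ^ n * Psi K (n + 1)) = lam K * -euler (sigmaNeg K) := by
  have h1 : PowerSeries.mk (fun n => (-1) ^ n * Psi K (n + 1)) = negVar (psi K) := rfl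
  have h2 : -euler (sigmaNeg K) = X * negVar (sigmaDeriv K) := by
    ext n
    rcases n with _ | n
    · simp [euler]
    · rw [coeff_succ_X_mul, map_neg, euler, coeff_mk, coeff_sigmaNeg, negVar, coeff_mk, sigmaDeriv,
        coeff_mk, pow_succ, Nat.cast_succ, ← mul_assoc, ← mul_assoc]
      rcases neg_one_pow_eq_or (NSym K) n with h | h
      · rw [h]; noncomm_ring
      · rw [h]; noncomm_ring
  rw [h1, psi, negVar_mul, lamNeg_eq, h2, ← mul_assoc, ← mul_assoc, X_mul]

/-- The noncommutative Newton identities, as an identity of series. -/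
theorem X_mul_psi_mul_lam :
    X * PowerSeries.mk (fun n => (-1) ^ n * Psi K (n + 1)) * lam K = euler (lam K) := by
  rw [X_mul_psi, mul_assoc, euler_sigmaNeg_mul_lam, ← mul_assoc, lam_mul_sigmaNeg, one_mul]

/-! ### The three expansions have the same generating series -/

/-- `∑ₙ (n + 1) S_n (-t)ⁿ`. -/
def denom : PowerSeries (NSym K) := sigmaNeg K + euler (sigmaNeg K)

/-- The constant term is S₀ = 1, so `denom` has a left inverse. -/
theorem denom_mul_cancel {f g : PowerSeries (NSym K)} (h : denom K * f = denom K * g) : f = g := by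
  have hd : invOfUnit (denom K) 1 * denom K = 1 := by
    rw [invOfUnit_mul]
    rw [← coeff_zero_eq_constantCoeff_apply, denom, map_add, euler, coeff_mk, coeff_sigmaNeg, S_zero]
    simp
  rw [← one_mul f, ← one_mul g, ← hd, mul_assoc, h, mul_assoc]

/-- The weight `ε^I Ψ^I` as a function of the list of parts. -/
def psiWeight (l : List ℕ) : NSym K := (l.map fun i => (-1) ^ (i - 1) * Psi K i).prod

theorem psiSeries_eq : PowerSeries.mk (compSum (psiWeight K)) =
    1 + X * PowerSeries.mk (fun n => (-1) ^ n * Psi K (n + 1)) *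
      PowerSeries.mk (compSum (psiWeight K)) := by
  have h := mk_compSum (psiWeight K) (psiWeight K) (fun i => (-1) ^ (i - 1) * Psi K i) 0
    (by simp [psiWeight])
  have e3 : X * PowerSeries.mk (fun n => (0 : ℕ → NSym K) (n + 1)) = 0 := by
    ext n
    rcases n with _ | n
    · simp
    · rw [coeff_succ_X_mul]; simp
  rw [e3, add_zero] at h
  simpa [psiWeight] using h

theorem denom_mul_psiSeries :
    denom K * PowerSeries.mk (compSum (psiWeight K)) = sigmaNeg K := by
  have h := psiSeries_eq K
  rw [X_mul_psi] at h
  set Z := PowerSeries.mk (compSum (psiWeight K))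
  have h1 : sigmaNeg K * Z = sigmaNeg K + -euler (sigmaNeg K) * Z := by
    conv_lhs => rw [h]
    rw [mul_add, mul_one, mul_assoc, ← mul_assoc, sigmaNeg_mul_lam, one_mul]
  rw [denom, add_mul, h1]
  noncomm_ring

/-- The weight `i₁ (i₂ - 1) ⋯ (i_l - 1) Λ^I` as a function of the list of parts. -/
def lamWeight (l : List ℕ) : NSym K := lamCoeff K l • (l.map (Lam K)).prod

theorem denom_mul_lamSeries :
    denom K * PowerSeries.mk (compSum (lamWeight K)) = sigmaNeg K := by
  -- The first part carries the exceptional factor i₁; `g` weights a tail, where every factor is j -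
  -- 1, and so satisfies a recursion by itself.
  let g : List ℕ → NSym K := fun l => (l.map fun j : ℕ => ((j : K) - 1) • Lam K j).prod
  have hg : ∀ l : List ℕ, g l = (l.map fun j : ℕ => (j : K) - 1).prod • (l.map (Lam K)).prod := by
    intro l
    induction l with
    | nil => simp [g]
    | cons i l ih =>
      simp only [g, List.map_cons, List.prod_cons] at ih ⊢
      rw [ih, smul_mul_smul_comm]
  have hW := mk_compSum g g (fun j => ((j : K) - 1) • Lam K j) 0 (by simp [g])
  have hY := mk_compSum (lamWeight K) g (fun j => (j : K) • Lam K j) 0 (by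
    intro i l
    rw [lamWeight, lamCoeff, hg, smul_mul_smul_comm]
    simp)
  have e1 : X * PowerSeries.mk (fun n => ((n + 1 : ℕ) : K) • Lam K (n + 1)) = euler (lam K) := by
    ext n
    rcases n with _ | n
    · simp [euler]
    · rw [coeff_succ_X_mul, coeff_mk, euler, coeff_mk, lam, coeff_mk, Nat.cast_smul_eq_nsmul,
        nsmul_eq_mul]
  have e2 : X * PowerSeries.mk (fun n => (((n + 1 : ℕ) : K) - 1) • Lam K (n + 1)) =
      1 + euler (lam K) - lam K := by
    ext n
    rcases n with _ | n
    · simp [euler, lam, Lam]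
    · rw [coeff_succ_X_mul, coeff_mk, map_sub, map_add, euler, coeff_mk, lam, coeff_mk, sub_smul,
        Nat.cast_smul_eq_nsmul, nsmul_eq_mul, one_smul, coeff_one, if_neg n.succ_ne_zero, zero_add]
  have e3 : X * PowerSeries.mk (fun n => (0 : ℕ → NSym K) (n + 1)) = 0 := by
    ext n
    rcases n with _ | n
    · simp
    · rw [coeff_succ_X_mul]; simp
  have g0 : g [] = 1 := by simp [g]
  have l0 : lamWeight K [] = 1 := by simp [lamWeight, lamCoeff]
  rw [e2, e3, g0, map_one, add_zero] at hW
  rw [e1, e3, l0, map_one, add_zero] at hY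
  rw [hY]
  set W := PowerSeries.mk (compSum g)
  -- Rearranging W = 1 + (1 + Eλ - λ)W; the left side is the series sought.
  have hYl : 1 + euler (lam K) * W = lam K * W := by
    have : W = 1 + euler (lam K) * W + W - lam K * W := by
      conv_lhs => rw [hW]
      noncomm_ring
    rw [← sub_eq_zero]
    rw [eq_comm, ← sub_eq_zero] at this
    rw [← this]
    noncomm_ring
  have key : denom K * lam K = sigmaNeg K * (lam K - euler (lam K)) := by
    rw [denom, add_mul, mul_sub, ← euler_sigmaNeg_mul_lam]
    noncomm_ring
  have hW1 : (lam K - euler (lam K)) * W = 1 := by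
    rw [sub_mul, ← hYl]
    noncomm_ring
  rw [hYl, ← mul_assoc, key, mul_assoc, hW1, mul_one]

end NCSF

end

noncomputable section

namespace NCSF

open PowerSeries

/-! ### The ribbon expansion -/

section Ribbon

/-- Refinement of lists of parts. -/
def ListRefines (l m : List ℕ) : Prop :=
  ∃ L : List (List ℕ), L.flatten = l ∧ L.map List.sum = m

/-- As j is positive, the first group is nonempty and starts with i. Deleting i may leave an empty
group, so a head of 0 has to be allowed on the coarse side. -/
theorem listRefines_cons_cons {i j : ℕ} {l m : List ℕ} (hj : 0 < j) :
    ListRefines (i :: l) (j :: m) ↔ i ≤ j ∧ ListRefines l ((j - i) :: m) := by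
  constructor
  · rintro ⟨_ | ⟨L₀, L⟩, h1, h2⟩
    · simp at h2
    · rw [List.map_cons, List.cons.injEq] at h2
      rcases L₀ with _ | ⟨a, t⟩
      · simp at h2; omega
      · rw [List.flatten_cons, List.cons_append, List.cons.injEq] at h1
        rw [List.sum_cons] at h2
        obtain ⟨rfl, rfl⟩ := h1
        refine ⟨by omega, t :: L, by simp, ?_⟩
        rw [List.map_cons, h2.2]
        congr 1
        omega
  · rintro ⟨hij, _ | ⟨t, L⟩, h1, h2⟩
    · simp at h2
    · rw [List.map_cons, List.cons.injEq] at h2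
      refine ⟨(i :: t) :: L, by simpa using h1, ?_⟩
      rw [List.map_cons, List.sum_cons, h2.1, h2.2]
      congr 1
      omega

theorem listRefines_zero_cons {l m : List ℕ} (hl : ∀ i ∈ l, 0 < i) :
    ListRefines l (0 :: m) ↔ ListRefines l m := by
  constructor
  · rintro ⟨_ | ⟨_ | ⟨a, t⟩, L⟩, h1, h2⟩
    · simp at h2
    · rw [List.map_cons, List.cons.injEq] at h2
      exact ⟨L, by simpa using h1, h2.2⟩
    · exfalso
      have := hl a (by rw [← h1]; simp)
      simp at h2
      omega
  · rintro ⟨L, h1, h2⟩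
    exact ⟨[] :: L, by simpa using h1, by simpa using h2⟩

variable (K : Type*) [Field K]

/-! ### Signed weights of refinements -/

/-- The sign `ε^I` as a product over the parts. -/
def partSign (l : List ℕ) : K := (l.map fun i => (-1) ^ (i - 1)).prod

theorem partSign_cons (i : ℕ) (l : List ℕ) : partSign K (i :: l) = (-1) ^ (i - 1) * partSign K l := by
  simp [partSign]

theorem partSign_eq (l : List ℕ) (hl : ∀ i ∈ l, 0 < i) :
    partSign K l = (-1) ^ (l.sum - l.length) := by
  induction l with
  | nil => simp [partSign]
  | cons i l ih =>
    have h : l.length ≤ l.sum := List.length_le_sum_of_one_le l fun i hi => hl i (by simp [hi])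
    have hi := hl i (by simp)
    rw [partSign_cons, ih fun i hi => hl i (by simp [hi]), ← pow_add, List.sum_cons,
      List.length_cons]
    congr 1
    omega

theorem sign_eq_partSign {n : ℕ} (I : Composition n) : sign K I = partSign K I.blocks := by
  rw [partSign_eq K _ fun _ h => I.blocks_pos h, I.blocks_sum, sign, Composition.blocks_length]

open Classical in
/-- The signed weight `ε^I 2^{m₁(I)}` of a list, supported on words in `1`, `2` ending in `1`. -/
def wordWeight (l : List ℕ) : K :=
  if (∀ i ∈ l, i = 1 ∨ i = 2) ∧ l.getLast? = some 1 then 2 ^ l.count 1 * partSign K l else 0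

/-- The correction arises because [] has weight 0, lacking a final 1, while [1] has weight 2. This
is the source of the factor 1/2 in the theorem. -/
theorem wordWeight_one_cons (l : List ℕ) :
    wordWeight K (1 :: l) = 2 * wordWeight K l + if l = [] then 2 else 0 := by
  rcases l with _ | ⟨a, l⟩
  · simp [wordWeight, partSign]
  · rw [if_neg (List.cons_ne_nil _ _), add_zero, wordWeight, wordWeight, mul_ite, mul_zero]
    refine if_congr ?_ ?_ rfl
    · rw [List.getLast?_cons_cons, List.forall_mem_cons]
      simp
    · rw [partSign_cons, List.count_cons_self, pow_succ]
      ring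

theorem wordWeight_two_cons (l : List ℕ) : wordWeight K (2 :: l) = -wordWeight K l := by
  rcases l with _ | ⟨a, l⟩
  · simp [wordWeight]
  · rw [wordWeight, wordWeight, ← mul_neg_one, ite_mul, zero_mul]
    refine if_congr ?_ ?_ rfl
    · rw [List.getLast?_cons_cons, List.forall_mem_cons]
      simp
    · rw [partSign_cons, List.count_cons_of_ne (by decide)]
      ring

theorem wordWeight_cons_of_two_lt {i : ℕ} (hi : 2 < i) (l : List ℕ) :
    wordWeight K (i :: l) = 0 := by
  rw [wordWeight, if_neg]
  rintro ⟨h, -⟩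
  have := h i (by simp)
  omega

open Classical in
/-- The total weight of the refinements of a composition. -/
def refinementSum (m : List ℕ) : K :=
  compSum (fun l => if ListRefines l m then wordWeight K l else 0) m.sum

theorem refinementSum_nil : refinementSum K [] = 0 := by
  rw [refinementSum, List.sum_nil, compSum_zero]
  simp [wordWeight]

theorem refinementSum_zero_cons (m : List ℕ) :
    refinementSum K (0 :: m) = refinementSum K m := by
  rw [refinementSum, refinementSum, List.sum_cons, zero_add]
  refine compSum_congr fun l hl _ => ?_
  rw [listRefines_zero_cons hl]

theorem compSum_mul_left {A : Type*} [NonUnitalNonAssocSemiring A] (a : A) (f : List ℕ → A)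
    (n : ℕ) : compSum (fun l => a * f l) n = a * compSum f n := by
  rw [compSum, compSum, Finset.mul_sum]

theorem compSum_eq_zero {A : Type*} [AddCommMonoid A] (f : List ℕ → A) (n : ℕ)
    (h : ∀ l, f l = 0) : compSum f n = 0 := by
  simp [compSum, h]

theorem refinementSum_one_cons (m : List ℕ) (hm : ∀ i ∈ m, 0 < i) :
    refinementSum K (1 :: m) = 2 * refinementSum K m + if m = [] then 2 else 0 := by
  classical
  rw [refinementSum, List.sum_cons, add_comm 1, compSum_succ, Finset.sum_range_succ',
    Finset.sum_eq_zero, zero_add, ← refinementSum_zero_cons]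
  · simp only [zero_add, Nat.sub_zero]
    rcases m with _ | ⟨a, m⟩
    · rw [refinementSum_zero_cons, refinementSum_nil, List.sum_nil, compSum_zero,
        if_pos, wordWeight_one_cons]
      · simp [wordWeight]
      · exact ⟨[[1]], rfl, rfl⟩
    · have ha := hm a (by simp)
      have e : (0 :: a :: m).sum = (a :: m).sum := by simp
      rw [if_neg (List.cons_ne_nil _ _), add_zero, refinementSum, e, ← compSum_mul_left]
      refine compSum_congr fun l hl hs => ?_
      have hl0 : l ≠ [] := by
        rintro rfl
        simp at hs
        omega
      rw [mul_ite, mul_zero, wordWeight_one_cons, if_neg hl0, add_zero]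
      refine if_congr ?_ rfl rfl
      rw [listRefines_cons_cons one_pos]
      simp
  · intro k _
    refine compSum_eq_zero _ _ fun l => ?_
    rw [if_neg]
    rw [listRefines_cons_cons one_pos]
    omega

/-- A refining word of nonzero weight starts with 1 or 2, contributing a factor 2 or -1 and lowering
the head by that amount. Vanishing second differences make the sum affine in the head. -/
theorem refinementSum_add_two_cons (j : ℕ) (m : List ℕ) :
    refinementSum K ((j + 2) :: m) =
      2 * refinementSum K ((j + 1) :: m) - refinementSum K (j :: m) := by
  classical
  have e : ((j + 2) :: m).sum = j + m.sum + 1 + 1 := by rw [List.sum_cons]; omega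
  rw [refinementSum, e, compSum_succ, Finset.sum_range_succ', Finset.sum_range_succ',
    Finset.sum_eq_zero, zero_add, add_comm, sub_eq_add_neg]
  · congr 1
    · simp only [zero_add, Nat.sub_zero]
      rw [refinementSum, ← compSum_mul_left, List.sum_cons, add_right_comm]
      refine compSum_congr fun l hl hs => ?_
      have hl0 : l ≠ [] := by
        rintro rfl
        rw [List.sum_nil] at hs
        omega
      rw [mul_ite, mul_zero, wordWeight_one_cons, if_neg hl0, add_zero]
      refine if_congr ?_ rfl rfl
      rw [listRefines_cons_cons (by omega)]
      simp
    · simp only [zero_add, Nat.add_sub_cancel]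
      rw [refinementSum, ← neg_one_mul, ← compSum_mul_left, List.sum_cons]
      refine compSum_congr fun l hl hs => ?_
      rw [mul_ite, mul_zero]
      refine if_congr ?_ (by rw [wordWeight_two_cons, neg_one_mul]) rfl
      rw [listRefines_cons_cons (by omega)]
      simp
  · intro k _
    refine compSum_eq_zero _ _ fun l => ?_
    rw [wordWeight_cons_of_two_lt K (by omega), ite_self]

/-- The coefficient `(j₁ + 1) ⋯ (j_{l-1} + 1) j_l` attached to a list `j₁, …, j_l`. -/
def endCoeff : List ℕ → K
  | [] => 0
  | j :: m => ((j : K) + 1) * endCoeff m + if m = [] then (j : K) else 0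

theorem refinementSum_eq (m : List ℕ) (hm : ∀ i ∈ m, 0 < i) :
    refinementSum K m = 2 * endCoeff K m := by
  induction m with
  | nil => rw [refinementSum_nil, endCoeff, mul_zero]
  | cons j m ih =>
    have hm' : ∀ i ∈ m, 0 < i := fun i hi => hm i (by simp [hi])
    have ih := ih hm'
    -- The two-step recursion starts from head 0, so positivity of the head must not enter the
    -- induction.
    clear hm
    rw [endCoeff]
    induction j using Nat.twoStepInduction with
    | zero => simp [refinementSum_zero_cons, ih]
    | one =>
      rw [refinementSum_one_cons K m hm', ih]
      split_ifs <;> push_cast <;> ring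
    | more j h1 h2 =>
      rw [refinementSum_add_two_cons, h1, h2]
      split_ifs <;> push_cast <;> ring

/-! ### From ribbons to complete functions -/

/-- The weight `ε^J (j₁ + 1) ⋯ (j_{l-1} + 1) j_l S^J` as a function of the list of parts. -/
def completeWeight (l : List ℕ) : NSym K := (endCoeff K l * partSign K l) • (l.map (S K)).prod

theorem half_sum_ribbon [CharZero K] (n : ℕ) :
    (1 / 2 : K) • ∑ I ∈ C n, (2 : K) ^ mOne I • ribbon K I = compSum (completeWeight K) n := by
  classical
  have h1 : ∑ I ∈ C n, (2 : K) ^ mOne I • ribbon K I =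
      ∑ J : Composition n, (refinementSum K J.blocks * sign K J) • SComp K J := by
    have hI : ∀ I : Composition n, (if I ∈ C n then (2 : K) ^ mOne I • ribbon K I else 0) =
        ∑ J : Composition n, ((if ListRefines I.blocks J.blocks then wordWeight K I.blocks else 0) *
          sign K J) • SComp K J := by
      intro I
      have hw : wordWeight K I.blocks = if I ∈ C n then (2 : K) ^ mOne I * sign K I else 0 := by
        rw [wordWeight, sign_eq_partSign]
        refine if_congr ?_ rfl rfl
        simp [C]
      rw [hw]
      split_ifs with hC
      · rw [ribbon, smul_smul, Finset.smul_sum, Finset.sum_filter]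
        refine Finset.sum_congr rfl fun J _ => ?_
        change (if ListRefines I.blocks J.blocks then _ else _) = _
        split_ifs
        · rw [smul_smul]
        · simp
      · simp
    have hC : ∑ I ∈ C n, (2 : K) ^ mOne I • ribbon K I =
        ∑ I, if I ∈ C n then (2 : K) ^ mOne I • ribbon K I else 0 := by
      rw [Finset.sum_ite_mem, Finset.univ_inter]
    rw [hC, Finset.sum_congr rfl fun I _ => hI I, Finset.sum_comm]
    refine Finset.sum_congr rfl fun J _ => ?_
    rw [← Finset.sum_smul, ← Finset.sum_mul, refinementSum, J.blocks_sum]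
    rfl
  rw [h1, Finset.smul_sum, compSum]
  refine Finset.sum_congr rfl fun J _ => ?_
  rw [refinementSum_eq K _ fun _ h => J.blocks_pos h, smul_smul, completeWeight, sign_eq_partSign,
    ← mul_assoc, ← mul_assoc, one_div, inv_mul_cancel₀ two_ne_zero, one_mul]
  rfl

/-- Splitting off the first part gives H = (1 - D)H - Eσ(-t). The added 1 is needed because the
empty composition has weight 0 here. -/
theorem denom_mul_completeSeries :
    denom K * (1 + PowerSeries.mk (compSum (completeWeight K))) = sigmaNeg K := by
  have h := mk_compSum (completeWeight K) (completeWeight K)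
    (fun i => (((i : K) + 1) * (-1) ^ (i - 1)) • S K i) (fun i => ((i : K) * (-1) ^ (i - 1)) • S K i)
    (by
      intro i l
      rw [completeWeight, completeWeight, endCoeff, partSign_cons, List.map_cons, List.prod_cons,
        smul_mul_smul_comm]
      split_ifs with hl
      · subst hl
        simp [endCoeff, partSign]
      · rw [add_zero, add_zero]
        congr 1
        ring)
  have hs : ∀ (a : ℕ) (n : ℕ), ((a : K) * (-1) ^ n) • S K (n + 1) =
      -((a : NSym K) * ((-1) ^ (n + 1) * S K (n + 1))) := by
    intro a n
    rw [mul_smul, Nat.cast_smul_eq_nsmul, nsmul_eq_mul]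
    rcases Nat.even_or_odd n with h | h
    · rw [h.neg_one_pow, h.add_one.neg_one_pow, one_smul]; noncomm_ring
    · rw [h.neg_one_pow, h.add_one.neg_one_pow]; simp
  have e1 : X * PowerSeries.mk (fun n => (((n + 1 : ℕ) : K) * (-1) ^ (n + 1 - 1)) • S K (n + 1)) =
      -euler (sigmaNeg K) := by
    ext n
    rcases n with _ | n
    · simp [euler]
    · rw [coeff_succ_X_mul, coeff_mk, map_neg, euler, coeff_mk, coeff_sigmaNeg, Nat.add_sub_cancel,
        hs]
  have e2 : X * PowerSeries.mk
      (fun n => ((((n + 1 : ℕ) : K) + 1) * (-1) ^ (n + 1 - 1)) • S K (n + 1)) = 1 - denom K := by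
    ext n
    rcases n with _ | n
    · rw [map_sub, denom, map_add, coeff_sigmaNeg, S_zero, euler, coeff_mk]
      simp
    · rw [coeff_succ_X_mul, coeff_mk, map_sub, denom, map_add, euler, coeff_mk, coeff_sigmaNeg,
        Nat.add_sub_cancel, ← Nat.cast_succ, hs, coeff_one, if_neg n.succ_ne_zero, Nat.cast_succ]
      noncomm_ring
  have h0 : completeWeight K [] = 0 := by simp [completeWeight, endCoeff]
  rw [e1, e2, h0, map_zero, zero_add] at h
  set H := PowerSeries.mk (compSum (completeWeight K))
  have h' : denom K * H = -euler (sigmaNeg K) := by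
    rw [sub_mul, one_mul] at h
    have h2 : denom K * H = H - (H - denom K * H) := by abel
    rw [h2]
    nth_rewrite 1 [h]
    abel
  rw [mul_add, mul_one, h', denom]
  abel

end Ribbon

end NCSF

end

noncomputable section

namespace NCSF

/-! ### Power sums and Newton's identities in infinitely many variables -/

section PowerSum

variable (K : Type*) [Field K]

open Classical in
/-- The power sum symmetric function `p_i`, for `i ≥ 1`, as a power series. -/
def powerSum (i : ℕ) : MvPowerSeries ℕ+ K :=
  fun d => if ∃ c, d = Finsupp.single c i then 1 else 0

/-- The power sum is an infinite sum of monomials x_c^i, but only variables occurring in d can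
contribute when i > 0. -/
theorem coeff_powerSum_mul {i : ℕ} (hi : 0 < i) (f : MvPowerSeries ℕ+ K) (d : ℕ+ →₀ ℕ) :
    MvPowerSeries.coeff d (powerSum K i * f) =
      ∑ c ∈ d.support, if i ≤ d c then MvPowerSeries.coeff (d - Finsupp.single c i) f else 0 := by
  classical
  have h : ∀ c, (if i ≤ d c then MvPowerSeries.coeff (d - Finsupp.single c i) f else 0) =
      ∑ p ∈ Finset.HasAntidiagonal.antidiagonal d,
        (if p.1 = Finsupp.single c i then MvPowerSeries.coeff p.2 f else 0) := by
    intro c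
    have := MvPowerSeries.coeff_monomial_mul d (Finsupp.single c i) f 1
    rw [one_mul, MvPowerSeries.coeff_mul] at this
    simp only [Finsupp.single_le_iff] at this
    rw [← this]
    refine Finset.sum_congr rfl fun p _ => ?_
    rw [MvPowerSeries.coeff_monomial]
    split_ifs <;> simp
  simp only [h]
  rw [Finset.sum_comm, MvPowerSeries.coeff_mul]
  refine Finset.sum_congr rfl fun p hp => ?_
  have hp := Finset.HasAntidiagonal.mem_antidiagonal.mp hp
  change (if _ then (1 : K) else 0) * _ = _
  by_cases hc : ∃ c, p.1 = Finsupp.single c i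
  · obtain ⟨c, hc⟩ := hc
    rw [if_pos ⟨c, hc⟩, one_mul, Finset.sum_eq_single c, if_pos hc]
    · intro c' _ hne
      rw [if_neg]
      intro h'
      rw [hc] at h'
      have := (Finsupp.single_left_inj hi.ne').mp h'
      exact hne this.symm
    · intro hcs
      exfalso
      have := DFunLike.congr_fun hp c
      rw [Finsupp.notMem_support_iff.mp hcs, Finsupp.add_apply, hc, Finsupp.single_eq_same] at this
      omega
  · rw [if_neg hc, zero_mul, Finset.sum_eq_zero]
    intro c _
    rw [if_neg fun h' => hc ⟨c, h'⟩]

/-- An alternating sum which telescopes. -/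
theorem sum_neg_one_pow_telescope {R : Type*} [CommRing R] (F : ℕ → R) (n : ℕ) :
    ∑ k ∈ Finset.range n, (-1) ^ k * (F k + F (k + 1)) = F 0 - (-1) ^ n * F n := by
  induction n with
  | zero => simp
  | succ n ih => rw [Finset.sum_range_succ, ih]; ring

/-- Newton's identities. -/
theorem newton_identity (n : ℕ) :
    ∑ k ∈ Finset.range (n + 1), (-1) ^ k * (powerSum K (k + 1) * (elem K (n - k)).1) =
      ((n + 1 : ℕ) : MvPowerSeries ℕ+ K) * (elem K (n + 1)).1 := by
  classical
  ext d
  have hE : ∀ (k : ℕ) (d : ℕ+ →₀ ℕ), MvPowerSeries.coeff d (elem K k).1 =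
    if d.degree = k ∧ ∀ i, d i ≤ 1 then 1 else 0 := fun k d => rfl
  have hpow : ∀ (k : ℕ) (f : MvPowerSeries ℕ+ K), MvPowerSeries.coeff d ((-1) ^ k * f) =
      (-1) ^ k * MvPowerSeries.coeff d f := by
    intro k f
    rcases Nat.even_or_odd k with h' | h' <;> simp [h'.neg_one_pow]
  rw [map_sum]
  simp only [hpow]
  have hcast : MvPowerSeries.coeff d (((n + 1 : ℕ) : MvPowerSeries ℕ+ K) * (elem K (n + 1)).1) =
      ((n + 1 : ℕ) : K) * MvPowerSeries.coeff d (elem K (n + 1)).1 := by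
    rw [← nsmul_eq_mul, map_nsmul, nsmul_eq_mul]
  rw [hcast, hE]
  by_cases hd : d.degree = n + 1
  swap
  · rw [if_neg (fun h => hd h.1), mul_zero]
    refine Finset.sum_eq_zero fun k hk => ?_
    rw [coeff_powerSum_mul K k.succ_pos, Finset.sum_eq_zero, mul_zero]
    intro c _
    split_ifs with hc
    · rw [hE, if_neg]
      rintro ⟨h, -⟩
      apply hd
      have h1 : d - Finsupp.single c (k + 1) + Finsupp.single c (k + 1) = d :=
        tsub_add_cancel_of_le (Finsupp.single_le_iff.mpr hc)
      rw [← h1, map_add, h, Finsupp.degree_single]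
      rw [Finset.mem_range] at hk
      omega
    · rfl
  -- Removing x_c^{k+1} leaves a squarefree monomial exactly when c has exponent k + 1 or k + 2 and
  -- the other exponents are at most 1. These two cases are consecutive terms of a telescoping sum.
  · have hterm : ∀ k ∈ Finset.range (n + 1), (-1 : K) ^ k *
        MvPowerSeries.coeff d (powerSum K (k + 1) * (elem K (n - k)).1) =
        ∑ c ∈ d.support, (-1 : K) ^ k *
          ((if d c = k + 1 ∧ ∀ i, i ≠ c → d i ≤ 1 then 1 else 0) +
          (if d c = k + 1 + 1 ∧ ∀ i, i ≠ c → d i ≤ 1 then 1 else 0)) := by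
      intro k hk
      rw [Finset.mem_range] at hk
      rw [coeff_powerSum_mul K k.succ_pos, Finset.mul_sum]
      refine Finset.sum_congr rfl fun c _ => ?_
      congr 1
      split_ifs with hc h1 h2 h2
      · omega
      · rw [hE, if_pos, add_zero]
        refine ⟨?_, ?_⟩
        · have h1 : d - Finsupp.single c (k + 1) + Finsupp.single c (k + 1) = d :=
            tsub_add_cancel_of_le (Finsupp.single_le_iff.mpr hc)
          have := congrArg Finsupp.degree h1
          rw [map_add, hd, Finsupp.degree_single] at this
          simp only [Nat.succ_eq_add_one] at this ⊢
          omega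
        · intro i
          by_cases hi : i = c
          · subst hi; simp; omega
          · have := h1.2 i hi
            simp [Ne.symm hi, this]
      · rw [hE, if_pos, zero_add]
        refine ⟨?_, ?_⟩
        · have h1 : d - Finsupp.single c (k + 1) + Finsupp.single c (k + 1) = d :=
            tsub_add_cancel_of_le (Finsupp.single_le_iff.mpr hc)
          have := congrArg Finsupp.degree h1
          rw [map_add, hd, Finsupp.degree_single] at this
          simp only [Nat.succ_eq_add_one] at this ⊢
          omega
        · intro i
          by_cases hi : i = c
          · subst hi; simp; omega
          · have := h2.2 i hi
            simp [Ne.symm hi, this]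
      · rw [hE, if_neg, add_zero]
        rintro ⟨-, h⟩
        have hr : ∀ i, i ≠ c → d i ≤ 1 := fun i hi => by
          have := h i
          simpa [Finsupp.single_apply, Ne.symm hi] using this
        have := h c
        simp at this
        have h3 : d c = k + 1 ∨ d c = k + 1 + 1 := by omega
        rcases h3 with h3 | h3
        · exact h1 ⟨h3, hr⟩
        · exact h2 ⟨h3, hr⟩
      all_goals first | omega | simp
    rw [Finset.sum_congr rfl hterm, Finset.sum_comm]
    have hc : ∀ c ∈ d.support, ∑ k ∈ Finset.range (n + 1), (-1 : K) ^ k *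
          ((if d c = k + 1 ∧ ∀ i, i ≠ c → d i ≤ 1 then 1 else 0) +
          (if d c = k + 1 + 1 ∧ ∀ i, i ≠ c → d i ≤ 1 then 1 else 0)) =
          if ∀ i, d i ≤ 1 then 1 else 0 := by
      intro c hc
      rw [sum_neg_one_pow_telescope
        (fun k => if d c = k + 1 ∧ ∀ i, i ≠ c → d i ≤ 1 then (1 : K) else 0)]
      have h1 : d c ≤ n + 1 := hd ▸ Finsupp.le_degree c d
      have h0 : d c ≠ 0 := Finsupp.mem_support_iff.mp hc
      simp only [zero_add]
      -- The far end of the telescope vanishes, since no exponent exceeds the degree n + 1.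
      rw [if_neg (c := d c = n + 1 + 1 ∧ _) (by omega), mul_zero, sub_zero]
      refine if_congr ⟨fun h i => ?_, fun h => ⟨?_, fun i _ => h i⟩⟩ rfl rfl
      · by_cases hi : i = c
        · rw [hi, h.1]
        · exact h.2 i hi
      · have := h c
        omega
    rw [Finset.sum_congr rfl hc, Finset.sum_const, nsmul_eq_mul]
    by_cases h : ∀ i, d i ≤ 1
    · rw [if_pos h, if_pos ⟨hd, h⟩]
      congr 2
      rw [← hd, Finsupp.degree_apply, Finset.card_eq_sum_ones]
      refine Finset.sum_congr rfl fun i hi => ?_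
      have := h i
      have := Finsupp.mem_support_iff.mp hi
      omega
    · rw [if_neg h, if_neg fun h' => h h'.2, mul_zero, mul_zero]

end PowerSum

/-! ### Proper colorings of paths -/

/-- The exponent vector of a word. -/
def wordMonomial (w : List ℕ+) : ℕ+ →₀ ℕ := (w.map fun c => Finsupp.single c 1).sum

/-- The words of length `n` with given exponent vector and distinct adjacent letters. -/
def properWords (n : ℕ) (d : ℕ+ →₀ ℕ) : Set (List ℕ+) :=
  {w | w.length = n ∧ w.IsChain (· ≠ ·) ∧ wordMonomial w = d}

theorem mem_support_of_mem {w : List ℕ+} {c : ℕ+} (h : c ∈ w) :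
    c ∈ (wordMonomial w).support := by
  induction w with
  | nil => simp at h
  | cons a w ih =>
    rw [wordMonomial, List.map_cons, List.sum_cons, Finsupp.mem_support_iff, Finsupp.add_apply]
    rcases List.mem_cons.mp h with rfl | h
    · simp
    · have := Finsupp.mem_support_iff.mp (ih h)
      rw [wordMonomial] at this
      omega

/-- All letters lie in the finite support of d. Without finiteness, `ncard` could be a meaningless
0. -/
theorem properWords_finite (n : ℕ) (d : ℕ+ →₀ ℕ) : (properWords n d).Finite := by
  refine (List.finite_length_eq d.support n).image (List.map Subtype.val) |>.subset ?_
  rintro w ⟨hn, -, rfl⟩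
  refine ⟨w.attach.map fun c => ⟨c.1, mem_support_of_mem c.2⟩, by simpa using hn, ?_⟩
  simp [List.map_map, Function.comp_def]

/-- The number of proper words with given first letter. -/
def headCount (n : ℕ) (d : ℕ+ →₀ ℕ) (c : ℕ+) : ℕ :=
  {w ∈ properWords n d | w.head? = some c}.ncard

theorem headCount_succ (n : ℕ) (d : ℕ+ →₀ ℕ) (c : ℕ+) :
    headCount (n + 1) (d + Finsupp.single c 1) c =
      {w ∈ properWords n d | w.head? ≠ some c}.ncard := by
  rw [headCount, ← Set.ncard_image_of_injective {w ∈ properWords n d | w.head? ≠ some c}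
    (List.cons_injective (a := c))]
  congr 1
  ext w
  constructor
  · intro hw
    obtain ⟨⟨h1, h2, h3⟩, h4⟩ := Set.mem_ofPred_eq.mp hw
    rcases w with _ | ⟨a, w⟩
    · simp at h4
    · obtain rfl : a = c := by simpa using h4
      rw [List.isChain_cons] at h2
      refine ⟨w, Set.mem_ofPred_eq.mpr ⟨⟨by simpa using h1, h2.2, ?_⟩, ?_⟩, rfl⟩
      · rw [wordMonomial, List.map_cons, List.sum_cons, add_comm] at h3
        exact add_right_cancel h3
      · intro h
        exact h2.1 a h rfl
  · rintro ⟨w, hw, rfl⟩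
    obtain ⟨⟨h1, h2, h3⟩, h4⟩ := Set.mem_ofPred_eq.mp hw
    refine ⟨⟨by simpa using h1, List.isChain_cons.mpr ⟨?_, h2⟩, ?_⟩, rfl⟩
    · rintro y hy rfl
      exact h4 hy
    · rw [wordMonomial, List.map_cons, List.sum_cons, add_comm, ← h3, wordMonomial]

/-- A proper word not starting with c can be prefixed by c, and this is reversible; the other words
are counted by the second term. This gives the telescoping in the path recursion. -/
theorem ncard_properWords (n : ℕ) (d : ℕ+ →₀ ℕ) (c : ℕ+) :
    (properWords n d).ncard =
      headCount (n + 1) (d + Finsupp.single c 1) c + headCount n d c := by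
  rw [headCount_succ, headCount, add_comm,
    ← Set.ncard_inter_add_ncard_sdiff_eq_ncard _ {w | w.head? = some c} (properWords_finite n d)]
  rfl

theorem headCount_zero (d : ℕ+ →₀ ℕ) (c : ℕ+) : headCount 0 d c = 0 := by
  rw [headCount, Set.ncard_eq_zero ((properWords_finite 0 d).subset (Set.sep_subset _ _))]
  ext w
  simp only [Set.mem_ofPred_eq, Set.mem_empty_iff_false, iff_false, not_and]
  rintro ⟨h, -⟩
  rw [List.length_eq_zero_iff.mp h]
  simp

theorem headCount_eq_zero {n : ℕ} {d : ℕ+ →₀ ℕ} {c : ℕ+} (h : d c = 0) : headCount n d c = 0 := by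
  rw [headCount, Set.ncard_eq_zero ((properWords_finite n d).subset (Set.sep_subset _ _))]
  ext w
  simp only [Set.mem_ofPred_eq, Set.mem_empty_iff_false, iff_false, not_and]
  rintro ⟨-, -, rfl⟩ h'
  exact Finsupp.mem_support_iff.mp (mem_support_of_mem (List.mem_of_head? h')) h

theorem ncard_properWords_succ (n : ℕ) (d : ℕ+ →₀ ℕ) :
    (properWords (n + 1) d).ncard = ∑ c ∈ d.support, headCount (n + 1) d c := by
  classical
  rw [Set.ncard_eq_toFinset_card _ (properWords_finite _ _),
    -- The default letter 1 is never used: the words have length n + 1.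
    Finset.card_eq_sum_card_fiberwise (f := fun w => w.head?.getD 1) (t := d.support)]
  · refine Finset.sum_congr rfl fun c _ => ?_
    rw [headCount, ← Set.ncard_coe_finset]
    congr 1
    ext w
    simp only [Finset.coe_filter, Set.Finite.mem_toFinset, Set.mem_ofPred_eq]
    refine and_congr_right fun h => ?_
    rcases w with _ | ⟨a, w⟩
    · simp [properWords] at h
    · simp
  · intro w hw
    have hw : w ∈ properWords (n + 1) d := by simpa using hw
    obtain ⟨h1, -, rfl⟩ := hw
    rcases w with _ | ⟨a, w⟩
    · simp at h1
    · exact mem_support_of_mem (by simp)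

theorem card_coloring_pathGraph (n : ℕ) (d : ℕ+ →₀ ℕ) :
    Nat.card {c : (SimpleGraph.pathGraph n).Coloring ℕ+ // colorMonomial c = d} =
      (properWords n d).ncard := by
  have hm : ∀ c : Fin n → ℕ+, wordMonomial (List.ofFn c) = colorMonomial c := by
    intro c
    rw [wordMonomial, List.map_ofFn, List.sum_ofFn]
    rfl
  rw [← Nat.card_coe_set_eq]
  refine Nat.card_eq_of_bijective (fun c => ⟨List.ofFn c.1, ?_⟩) ⟨?_, ?_⟩
  · refine ⟨by simp, ?_, (hm _).trans c.2⟩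
    rw [List.isChain_ofFn]
    intro i hi
    exact c.1.valid (SimpleGraph.pathGraph_adj.mpr (Or.inl rfl))
  · intro c c' h
    have h := List.ofFn_injective (congrArg Subtype.val h)
    exact Subtype.ext (RelHom.ext fun v => congrFun h v)
  · rintro ⟨w, rfl, h2, h3⟩
    have hw : List.ofFn w.get = w := List.ofFn_get w
    rw [← hw, List.isChain_ofFn] at h2
    refine ⟨⟨SimpleGraph.Coloring.mk w.get ?_, ?_⟩, Subtype.ext hw⟩
    · intro u v huv
      rcases SimpleGraph.pathGraph_adj.mp huv with h | h
      · have := h2 u.1 (by omega)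
        convert this using 2
        exact Fin.ext h.symm
      · have := h2 v.1 (by omega)
        refine Ne.symm ?_
        convert this using 2
        exact Fin.ext h.symm
    · rw [← h3]
      conv_rhs => rw [← hw]
      exact (hm _).symm

/-! ### The recursion for chromatic symmetric functions of paths -/

variable (K : Type*) [Field K]

theorem coeff_chromaticSym_pathGraph (n : ℕ) (d : ℕ+ →₀ ℕ) :
    MvPowerSeries.coeff d (chromaticSym K (SimpleGraph.pathGraph n)).1 =
      ((properWords n d).ncard : K) := by
  rw [← card_coloring_pathGraph]
  rfl

theorem chromaticSym_pathGraph_zero : (chromaticSym K (SimpleGraph.pathGraph 0)).1 = 1 := by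
  classical
  ext d
  rw [coeff_chromaticSym_pathGraph, MvPowerSeries.coeff_one]
  split_ifs with h
  · have : properWords 0 d = {[]} := by
      ext w
      simp only [properWords, Set.mem_ofPred_eq, Set.mem_singleton_iff, List.length_eq_zero_iff]
      refine ⟨fun h => h.1, ?_⟩
      rintro rfl
      exact ⟨rfl, List.isChain_nil, by simp [wordMonomial, h]⟩
    simp [this]
  · have : properWords 0 d = ∅ := by
      ext w
      simp only [properWords, Set.mem_ofPred_eq, List.length_eq_zero_iff, Set.mem_empty_iff_false,
        iff_false]
      rintro ⟨rfl, -, h'⟩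
      exact h (by rw [← h']; rfl)
    simp [this]

/-- The expansion of the chromatic symmetric functions of paths by length of the initial
monochromatic run. -/
theorem chromaticSym_pathGraph_succ (n : ℕ) :
    (chromaticSym K (SimpleGraph.pathGraph (n + 1))).1 =
      ∑ k ∈ Finset.range (n + 1),
        (-1) ^ k * (powerSum K (k + 1) * (chromaticSym K (SimpleGraph.pathGraph (n - k))).1) := by
  ext d
  have hpow : ∀ (k : ℕ) (f : MvPowerSeries ℕ+ K), MvPowerSeries.coeff d ((-1) ^ k * f) =
      (-1) ^ k * MvPowerSeries.coeff d f := by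
    intro k f
    rcases Nat.even_or_odd k with h' | h' <;> simp [h'.neg_one_pow]
  rw [map_sum]
  simp only [hpow]
  rw [coeff_chromaticSym_pathGraph, ncard_properWords_succ]
  -- `F c k` counts proper words starting with c after k copies of c are removed from the exponent
  -- vector and k from the length. The coefficient of each product is then a sum of terms `F c k + F
  -- c (k + 1)`.
  let F : ℕ+ → ℕ → K := fun c k =>
    if k ≤ d c then (headCount (n + 1 - k) (d - Finsupp.single c k) c : K) else 0
  have hterm : ∀ k ∈ Finset.range (n + 1), (-1 : K) ^ k * MvPowerSeries.coeff d
      (powerSum K (k + 1) * (chromaticSym K (SimpleGraph.pathGraph (n - k))).1) =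
      ∑ c ∈ d.support, (-1) ^ k * (F c k + F c (k + 1)) := by
    intro k hk
    rw [Finset.mem_range] at hk
    rw [coeff_powerSum_mul K k.succ_pos, Finset.mul_sum]
    refine Finset.sum_congr rfl fun c _ => ?_
    congr 1
    by_cases hc : k + 1 ≤ d c
    · simp only [F]
      rw [if_pos hc, if_pos hc, if_pos (by omega), coeff_chromaticSym_pathGraph,
        ncard_properWords _ _ c, Nat.cast_add]
      have e1 : n + 1 - k = n - k + 1 := by omega
      have e2 : n + 1 - (k + 1) = n - k := by omega
      have e3 : d - Finsupp.single c k =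
          d - Finsupp.single c (k + 1) + Finsupp.single c 1 := by
        ext i
        by_cases hi : i = c
        · subst hi; simp; omega
        · simp [Ne.symm hi]
      rw [e1, e2, e3]
    -- At k = d c no copy of c remains, so no word can start with c; beyond that `F` is 0 by
    -- definition.
    · simp only [F]
      rw [if_neg hc, if_neg hc, add_zero]
      split_ifs with h
      · rw [headCount_eq_zero, Nat.cast_zero]
        simp
        omega
      · rfl
  rw [Finset.sum_congr rfl hterm, Finset.sum_comm, Nat.cast_sum]
  refine Finset.sum_congr rfl fun c _ => ?_
  rw [sum_neg_one_pow_telescope]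
  simp [F, headCount_zero]

end NCSF

end

noncomputable section

namespace NCSF

open PowerSeries

/-! ### The commutative image -/

section Rho

variable (K : Type*) [Field K]

/-- The projection `ρ` with values in power series. -/
def rhoVal : NSym K →ₐ[K] MvPowerSeries ℕ+ K := (Sym K).val.comp (rho K)

theorem elem_zero : (elem K 0).1 = 1 := by
  classical
  ext d
  rw [MvPowerSeries.coeff_one]
  change (if _ then (1 : K) else 0) = _
  refine if_congr ⟨fun h => ?_, fun h => ?_⟩ rfl rfl
  · exact (Finsupp.degree_eq_zero_iff d).mp h.1
  · subst h
    simp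

theorem rhoVal_Lam (k : ℕ) : rhoVal K (Lam K k) = (elem K k).1 := by
  rcases k with _ | k
  · rw [elem_zero, Lam, map_one]
  · simp [rhoVal, Lam, rho]

/-- The noncommutative Newton identities map to the classical ones; by induction all terms but the
last agree, so the last ones do too. -/
theorem rhoVal_Psi (n : ℕ) : rhoVal K (Psi K (n + 1)) = powerSum K (n + 1) := by
  induction n using Nat.strong_induction_on with
  | _ n ih =>
    have h := congrArg (fun f => rhoVal K (coeff (n + 1) f)) (X_mul_psi_mul_lam K)
    rw [mul_assoc, coeff_succ_X_mul, coeff_mul, Finset.Nat.sum_antidiagonal_eq_sum_range_succ_mk,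
      euler, coeff_mk, lam, coeff_mk, map_mul, map_natCast, rhoVal_Lam, ← newton_identity, map_sum,
      Finset.sum_range_succ, Finset.sum_range_succ] at h
    simp only [coeff_mk, map_mul, map_pow, map_neg, map_one, rhoVal_Lam, Nat.sub_self, elem_zero,
      mul_one] at h
    rw [Finset.sum_congr rfl fun k hk => by
      rw [ih k (Finset.mem_range.mp hk), mul_assoc]] at h
    have h := add_left_cancel h
    rcases neg_one_pow_eq_or (MvPowerSeries ℕ+ K) n with h' | h'
    · simpa [h'] using h
    · simpa [h'] using h

theorem rhoVal_compSum_psiWeight (n : ℕ) :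
    rhoVal K (compSum (psiWeight K) n) = (chromaticSym K (SimpleGraph.pathGraph n)).1 := by
  induction n using Nat.strong_induction_on with
  | _ n ih =>
    rcases n with _ | n
    · rw [compSum_zero, chromaticSym_pathGraph_zero]
      simp [psiWeight]
    · rw [chromaticSym_pathGraph_succ, compSum_succ, map_sum]
      refine Finset.sum_congr rfl fun k _ => ?_
      simp only [psiWeight, List.map_cons, List.prod_cons]
      rw [compSum_mul_left, map_mul, map_mul, rhoVal_Psi, Nat.add_sub_cancel, map_pow, map_neg,
        map_one, mul_assoc]
      congr 2
      exact ih _ (by omega)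

theorem sign_smul_PsiComp {n : ℕ} (I : Composition n) :
    sign K I • PsiComp K I = psiWeight K I.blocks := by
  rw [sign_eq_partSign, PsiComp, partSign, psiWeight]
  induction I.blocks with
  | nil => simp
  | cons i l ih =>
    simp only [List.map_cons, List.prod_cons]
    rw [← smul_mul_smul_comm, ih]
    congr 1
    rcases Nat.even_or_odd (i - 1) with h | h <;> simp [h.neg_one_pow]

end Rho

end NCSF

end

/-! ### The main theorem -/

theorem theorem3p3 (K : Type*) [Field K] [CharZero K] (n : ℕ) (hn : 1 ≤ n) :
    ∃ X : NCSF.NSym K,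
      NCSF.IsNoncommAnalog X (NCSF.chromaticSym K (SimpleGraph.pathGraph n)) ∧
      X = ∑ I : Composition n, NCSF.sign K I • NCSF.PsiComp K I ∧
      X = ∑ I : Composition n, NCSF.lamCoeff K I.blocks • NCSF.LamComp K I ∧
      X = (1 / 2 : K) • ∑ I ∈ NCSF.C n, (2 : K) ^ NCSF.mOne I • NCSF.ribbon K I := by
  refine ⟨NCSF.compSum (NCSF.psiWeight K) n,
    Subtype.ext (NCSF.rhoVal_compSum_psiWeight K n), ?_, ?_, ?_⟩
  · exact Finset.sum_congr rfl fun I _ => (NCSF.sign_smul_PsiComp K I).symm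
  · have h := NCSF.denom_mul_cancel K
      ((NCSF.denom_mul_psiSeries K).trans (NCSF.denom_mul_lamSeries K).symm)
    have h := congrArg (PowerSeries.coeff n) h
    rw [PowerSeries.coeff_mk, PowerSeries.coeff_mk] at h
    exact h
  · have h := NCSF.denom_mul_cancel K
      ((NCSF.denom_mul_psiSeries K).trans (NCSF.denom_mul_completeSeries K).symm)
    have h := congrArg (PowerSeries.coeff n) h
    -- As n ≥ 1, the summand 1 in 1 + H does not affect the coefficient.
    rw [PowerSeries.coeff_mk, map_add, PowerSeries.coeff_mk, PowerSeries.coeff_one,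
      if_neg (by omega), zero_add] at h
    rw [h, NCSF.half_sum_ribbon]
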